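/- Let $K$ be a field and let $R=\bigoplus_{d\ge 0}R_d$ be a graded finitely generated commutative $K$-algebra with $R_0=K$ that is a factorial domain (a unique factorization domain). Put $R_+=\bigoplus_{d\ge 1}R_d$. For a nonzero finitely generated graded $R$-module $M$, let $\operatorname{depth}(M)$ be the maximal length $k$ of a sequence of homogeneous elements $a_1,\dots,a_k\in R_+$ such that each $a_i$ is a nonzerodivisor on $M/(a_1,\dots,a_{i-1})M$, let $\dim(M)$ be the Krull dimension of $R/\operatorname{Ann}_R(M)$, and call $M$ Cohen–Macaulay if $\operatorname{depth}(M)=\dim(M)$. Then: (1) If $I\ne R$ is a homogeneous ideal of $R$ that is not principal, then $I$ is not Cohen–Macaulay as an $R$-module. (2) Consequently, if $R$ is not Cohen–Macaulay (as a module over itself), then no nonzero homogeneous ideal of $R$ is Cohen–Macaulay as an $R$-module. -/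

import Mathlib

namespace GradedCM

variable {K R : Type*} [Field K] [CommRing R] [Algebra K R]
  (𝒜 : ℕ → Submodule K R) [GradedAlgebra 𝒜]

/-- The grade of `I` on `M`, for an ideal `I` contained in `R₊`: the maximal length of a sequence
`a₁, …, aₖ` of homogeneous elements lying in `I` such that each `aᵢ` is a nonzerodivisor on
`M / (a₁, …, aᵢ₋₁) M`. It is a supremum in `ℕ∞`. For a nonzero finitely generated graded
module `M` over an affine `R`, the condition `M ≠ (a₁, …, aₖ) M` is automatic, by
Nakayama's lemma. -/
noncomputable def grade (I : Ideal R) (M : Type*) [AddCommGroup M] [Module R M] : ℕ∞ :=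
  ⨆ (rs : List R) (_ : ∀ a ∈ rs, SetLike.IsHomogeneousElem 𝒜 a ∧ a ∈ I)
    (_ : RingTheory.Sequence.IsWeaklyRegular M rs), (rs.length : ℕ∞)

/-- The depth of `M`, that is, the grade of `R₊ = ⨁_{d > 0} R_d` on `M`. -/
noncomputable def depth (M : Type*) [AddCommGroup M] [Module R M] : ℕ∞ :=
  grade 𝒜 (HomogeneousIdeal.irrelevant 𝒜).toIdeal M

/-- The Krull dimension of `M`, that is, the Krull dimension of the ring `R / Ann_R(M)`. -/
noncomputable def dim (R : Type*) [CommRing R] (M : Type*) [AddCommGroup M] [Module R M] :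
    WithBot ℕ∞ :=
  ringKrullDim (R ⧸ Module.annihilator R M)

/-- `M` is Cohen-Macaulay as an `R`-module: `depth M = dim M`. The notion is meant for nonzero
finitely generated graded modules (the zero module has depth `⊤` and dimension `⊥` here,
so it does not satisfy it). -/
def IsCohenMacaulay (M : Type*) [AddCommGroup M] [Module R M] : Prop :=
  ((depth 𝒜 M : ℕ∞) : WithBot ℕ∞) = dim R M

end GradedCM

/-! Write a nonzero ideal as `I = fJ` with `J` contained in no principal prime ideal. Then `J ≅ I`
as modules, and `J` is again homogeneous. If `I` is not principal, then `J ≠ R`, so `J ⊆ R₊` because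
`R₀ = K`. For nonzero `a ∈ J`, the class of `a` in `J/aJ` is nonzero and killed by `J`, so `J` lies
in an associated prime `P` of `J/aJ`. Depth is bounded by the dimension of associated primes, and
passing to `J/aJ` costs one, so `depth J ≤ dim R/P + 1`; this is proved after localizing at `R₊`,
where Nakayama applies (`length_le_ringKrullDim_quotient_add_one`). By factoriality `P` strictly
contains some nonzero `(p)`, so `dim R/P + 2 ≤ dim R = dim J`. Hence `depth J < dim J`. Part (2)
follows because a nonzero principal ideal is isomorphic to `R`. -/

open IsLocalRing RingTheory.Sequence
open scoped Pointwise

/-! ### Annihilated elements and regular elements in quotients `M/xM` -/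

section Module

variable {S M : Type*} [CommRing S] [AddCommGroup M] [Module S M]

/-- The ideal `P` annihilates a nonzero element of `M`. -/
def AnnihilatesNonzero (P : Ideal S) (M : Type*) [AddCommGroup M] [Module S M] : Prop :=
  ∃ u : M, u ≠ 0 ∧ ∀ p ∈ P, p • u = 0

lemma QuotSMulTop.mk_eq_zero_iff {x : S} {m : M} :
    (Submodule.Quotient.mk m : QuotSMulTop x M) = 0 ↔ ∃ w : M, x • w = m := by
  simp [Submodule.Quotient.mk_eq_zero, Submodule.mem_smul_pointwise_iff_exists]

lemma QuotSMulTop.mk_mk_eq_zero_iff {x y : S} {m : M} :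
    (Submodule.Quotient.mk (Submodule.Quotient.mk m : QuotSMulTop x M) :
      QuotSMulTop y (QuotSMulTop x M)) = 0 ↔ ∃ v w : M, x • v + y • w = m := by
  rw [QuotSMulTop.mk_eq_zero_iff]
  constructor
  · rintro ⟨w, hw⟩
    obtain ⟨w, rfl⟩ := Submodule.Quotient.mk_surjective _ w
    rw [← Submodule.Quotient.mk_smul, eq_comm, ← sub_eq_zero, ← Submodule.Quotient.mk_sub,
      QuotSMulTop.mk_eq_zero_iff] at hw
    obtain ⟨v, hv⟩ := hw
    exact ⟨v, w, by rw [hv]; abel⟩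
  · rintro ⟨v, w, rfl⟩
    refine ⟨Submodule.Quotient.mk w, ?_⟩
    rw [Submodule.Quotient.mk_add, QuotSMulTop.mk_eq_zero_iff.mpr ⟨v, rfl⟩, zero_add,
      Submodule.Quotient.mk_smul]

lemma AnnihilatesNonzero.quotSMulTop_swap {P : Ideal S} {x y : S}
    (h : AnnihilatesNonzero P (QuotSMulTop y (QuotSMulTop x M))) :
    AnnihilatesNonzero P (QuotSMulTop x (QuotSMulTop y M)) := by
  obtain ⟨u, hu, hP⟩ := h
  obtain ⟨u, rfl⟩ := Submodule.Quotient.mk_surjective _ u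
  obtain ⟨m, rfl⟩ := Submodule.Quotient.mk_surjective _ u
  refine ⟨Submodule.Quotient.mk (Submodule.Quotient.mk m), ?_, fun p hp ↦ ?_⟩
  · rw [Ne, QuotSMulTop.mk_mk_eq_zero_iff] at hu ⊢
    rintro ⟨v, w, rfl⟩
    exact hu ⟨w, v, add_comm _ _⟩
  · have := hP p hp
    rw [← Submodule.Quotient.mk_smul, ← Submodule.Quotient.mk_smul,
      QuotSMulTop.mk_mk_eq_zero_iff] at this ⊢
    obtain ⟨v, w, h⟩ := this
    exact ⟨w, v, by rw [add_comm, h]⟩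

/-- The socle of `M / aM` with respect to `P` does not depend on the `M`-regular `a ∈ P`. -/
lemma AnnihilatesNonzero.quotSMulTop_of_isSMulRegular {P : Ideal S} {a b : S}
    (ha : IsSMulRegular M a) (hb : IsSMulRegular M b) (hbP : b ∈ P)
    (h : AnnihilatesNonzero P (QuotSMulTop a M)) : AnnihilatesNonzero P (QuotSMulTop b M) := by
  obtain ⟨u, hu, hP⟩ := h
  obtain ⟨m, rfl⟩ := Submodule.Quotient.mk_surjective _ u
  rw [Ne, QuotSMulTop.mk_eq_zero_iff] at hu
  have hP' : ∀ p ∈ P, ∃ w : M, a • w = p • m := fun p hp ↦ by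
    simpa only [← Submodule.Quotient.mk_smul, QuotSMulTop.mk_eq_zero_iff] using hP p hp
  -- The socle is transported by `m ↦ v`, where `a v = b m`.
  obtain ⟨v, hv⟩ := hP' b hbP
  refine ⟨Submodule.Quotient.mk v, ?_, fun p hp ↦ ?_⟩
  · rw [Ne, QuotSMulTop.mk_eq_zero_iff]
    rintro ⟨w, rfl⟩
    exact hu ⟨w, hb (by simpa only [smul_comm b a] using hv)⟩
  · obtain ⟨w, hw⟩ := hP' p hp
    rw [← Submodule.Quotient.mk_smul, QuotSMulTop.mk_eq_zero_iff]
    refine ⟨w, ha ?_⟩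
    simp only
    rw [smul_comm a b, hw, smul_comm a p, hv, smul_comm]

lemma isSMulRegular_quotSMulTop_swap {x a : S}
    (hxa : IsSMulRegular (QuotSMulTop x M) a) (hx : IsSMulRegular M x) : IsSMulRegular (QuotSMulTop a M) x := by
  rw [isSMulRegular_iff_right_eq_zero_of_smul] at hxa ⊢
  intro u hu
  obtain ⟨m, rfl⟩ := Submodule.Quotient.mk_surjective _ u
  rw [← Submodule.Quotient.mk_smul, QuotSMulTop.mk_eq_zero_iff] at hu
  obtain ⟨v, hv⟩ := hu
  have h0 : (Submodule.Quotient.mk v : QuotSMulTop x M) = 0 := by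
    apply hxa
    rw [← Submodule.Quotient.mk_smul, QuotSMulTop.mk_eq_zero_iff]
    exact ⟨m, hv.symm⟩
  obtain ⟨w, rfl⟩ := QuotSMulTop.mk_eq_zero_iff.mp h0
  rw [QuotSMulTop.mk_eq_zero_iff]
  exact ⟨w, hx (by simpa only [smul_comm x a] using hv)⟩

lemma exists_isPrime_annihilatesNonzero [IsNoetherianRing S] {P : Ideal S}
    (h : AnnihilatesNonzero P M) :
    ∃ Q : Ideal S, Q.IsPrime ∧ P ≤ Q ∧ AnnihilatesNonzero Q M := by
  obtain ⟨u, hu, hP⟩ := h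
  obtain ⟨Q, hQ, hle⟩ := exists_le_isAssociatedPrime_of_isNoetherianRing S u hu
  obtain ⟨hprime, v, rfl⟩ := isAssociatedPrime_iff.mp hQ
  refine ⟨_, hprime, fun p hp ↦ hle ?_, v, ?_, fun p hp ↦ ?_⟩
  · simpa [Submodule.mem_colon_singleton] using hP p hp
  · rintro rfl
    exact hprime.ne_top (by ext; simp [Submodule.mem_colon_singleton])
  · simpa [Submodule.mem_colon_singleton] using hp

/-- Prime avoidance: the zero divisors on `M` form the finite union of its associated primes. -/
lemma exists_isPrime_annihilatesNonzero_of_forall_not_isSMulRegular [IsNoetherianRing S]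
    [Module.Finite S M] {P : Ideal S} (h : ∀ a ∈ P, ¬ IsSMulRegular M a) :
    ∃ Q : Ideal S, Q.IsPrime ∧ P ≤ Q ∧ AnnihilatesNonzero Q M := by
  have hP : (P : Set S) ⊆ ⋃ p ∈ associatedPrimes S M, p := by
    rw [biUnion_associatedPrimes_eq_compl_regular S M]
    exact h
  obtain ⟨Q, hQ, hle⟩ := (Ideal.subset_union_prime_finite (associatedPrimes.finite S M) ⊥ ⊥
    (fun I hI _ _ ↦ IsAssociatedPrime.isPrime hI)).mp hP
  obtain ⟨hprime, v, rfl⟩ := isAssociatedPrime_iff.mp hQ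
  refine ⟨_, hprime, hle, v, ?_, fun p hp ↦ ?_⟩
  · rintro rfl
    exact hprime.ne_top (by ext; simp [Submodule.mem_colon_singleton])
  · simpa [Submodule.mem_colon_singleton] using hp

lemma ringKrullDim_quotient_add_one_le_of_lt {P Q : Ideal S} [P.IsPrime] (h : P < Q) :
    ringKrullDim (S ⧸ Q) + 1 ≤ ringKrullDim (S ⧸ P) := by
  obtain ⟨x, hxQ, hxP⟩ := SetLike.exists_of_lt h
  refine ringKrullDim_succ_le_of_surjective (Ideal.Quotient.factor h.le)
    (Ideal.Quotient.factor_surjective h.le) (r := Ideal.Quotient.mk P x) ?_ ?_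
  · rw [mem_nonZeroDivisors_iff_ne_zero, Ne, Ideal.Quotient.eq_zero_iff_mem]
    exact hxP
  · rw [Ideal.Quotient.factor_mk, Ideal.Quotient.eq_zero_iff_mem]
    exact hxQ

end Module

/-! ### Depth bounds over a Noetherian local ring -/

section Local

variable {S : Type*} [CommRing S] [IsNoetherianRing S] [IsLocalRing S]

lemma Submodule.eq_bot_of_forall_exists_smul_eq {M : Type*} [AddCommGroup M] [Module S M]
    [Module.Finite S M] {N : Submodule S M} {x : S} (hx : x ∈ maximalIdeal S)
    (h : ∀ m ∈ N, ∃ n ∈ N, x • n = m) : N = ⊥ := by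
  refine Submodule.eq_bot_of_le_smul_of_le_jacobson_bot (maximalIdeal S) N
    (IsNoetherian.noetherian N) (fun m hm ↦ ?_) (IsLocalRing.maximalIdeal_le_jacobson _)
  obtain ⟨n, hn, rfl⟩ := h m hm
  exact Submodule.smul_mem_smul hx hn

/-- The `a`-torsion `T` satisfies `T = xT`, so Nakayama kills it. -/
lemma isSMulRegular_of_isSMulRegular_quotSMulTop {M : Type*} [AddCommGroup M] [Module S M]
    [Module.Finite S M] {x a : S} (hxm : x ∈ maximalIdeal S) (hx : IsSMulRegular M x)
    (h : IsSMulRegular (QuotSMulTop x M) a) : IsSMulRegular M a := by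
  rw [isSMulRegular_iff_torsionBy_eq_bot]
  rw [isSMulRegular_iff_right_eq_zero_of_smul] at h hx
  refine Submodule.eq_bot_of_forall_exists_smul_eq hxm fun m hm ↦ ?_
  rw [Submodule.mem_torsionBy_iff] at hm
  have h0 : (Submodule.Quotient.mk m : QuotSMulTop x M) = 0 := by
    apply h
    rw [← Submodule.Quotient.mk_smul, hm, Submodule.Quotient.mk_zero]
  obtain ⟨w, rfl⟩ := QuotSMulTop.mk_eq_zero_iff.mp h0
  refine ⟨w, ?_, rfl⟩
  rw [Submodule.mem_torsionBy_iff]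
  apply hx
  rw [smul_comm, hm]

/-- The elements killed by `P` form a nonzero submodule `N`, and Nakayama gives `m ∈ N` outside
`xN`. Since `x` is regular, `m ∉ xM`; its class is killed by `P + (x)`, and `x ∉ P` makes the
inclusion strict. -/
lemma AnnihilatesNonzero.exists_quotSMulTop {M : Type*} [AddCommGroup M] [Module S M]
    [Module.Finite S M] {x : S} (hxm : x ∈ maximalIdeal S) (hx : IsSMulRegular M x)
    {P : Ideal S} (h : AnnihilatesNonzero P M) :
    ∃ Q : Ideal S, Q.IsPrime ∧ P < Q ∧ AnnihilatesNonzero Q (QuotSMulTop x M) := by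
  have hx' := isSMulRegular_iff_right_eq_zero_of_smul.mp hx
  obtain ⟨u, hu, hP⟩ := h
  have hxP : x ∉ P := fun hxP ↦ hu (hx' _ (hP x hxP))
  let N : Submodule S M := Submodule.torsionBySet S M P
  have hN : ¬ ∀ m ∈ N, ∃ n ∈ N, x • n = m := fun hN ↦ by
    have huN : u ∈ N := (Submodule.mem_torsionBySet_iff _ _).mpr fun p ↦ hP p p.2
    rw [Submodule.eq_bot_of_forall_exists_smul_eq hxm hN] at huN
    exact hu huN
  push Not at hN
  obtain ⟨m, hm, hmx⟩ := hN
  have hm' : ∀ p ∈ P, p • m = 0 := fun p hp ↦ (Submodule.mem_torsionBySet_iff _ _).mp hm ⟨p, hp⟩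
  have key : AnnihilatesNonzero (P ⊔ Ideal.span {x}) (QuotSMulTop x M) := by
    refine ⟨Submodule.Quotient.mk m, ?_, fun p hp ↦ ?_⟩
    · rw [Ne, QuotSMulTop.mk_eq_zero_iff]
      rintro ⟨w, rfl⟩
      refine hmx w ((Submodule.mem_torsionBySet_iff _ _).mpr fun p ↦ hx' _ ?_) rfl
      rw [smul_comm]
      exact hm' p p.2
    · obtain ⟨q, hq, y, hy, rfl⟩ := Submodule.mem_sup.mp hp
      obtain ⟨c, rfl⟩ := Ideal.mem_span_singleton'.mp hy
      rw [← Submodule.Quotient.mk_smul, QuotSMulTop.mk_eq_zero_iff]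
      exact ⟨c • m, by rw [add_smul, hm' q hq, zero_add, mul_smul, smul_comm]⟩
  obtain ⟨Q, hQ, hle, h⟩ := exists_isPrime_annihilatesNonzero key
  refine ⟨Q, hQ, lt_of_le_of_ne (le_sup_left.trans hle) ?_, h⟩
  rintro rfl
  exact hxP (hle (Ideal.mem_sup_right (Ideal.mem_span_singleton_self x)))

/-- The depth of a module is at most the dimension of each of its associated primes. -/
lemma length_le_ringKrullDim_quotient_of_annihilatesNonzero (rs : List S) :
    ∀ {M : Type*} [AddCommGroup M] [Module S M] [Module.Finite S M],
      (∀ r ∈ rs, r ∈ maximalIdeal S) → IsWeaklyRegular M rs →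
      ∀ {P : Ideal S}, P.IsPrime → AnnihilatesNonzero P M →
        (rs.length : WithBot ℕ∞) ≤ ringKrullDim (S ⧸ P) := by
  induction rs with
  | nil =>
    intro M _ _ _ _ _ P hP _
    simpa using ringKrullDim_nonneg_of_nontrivial
  | cons x rs ih =>
    intro M _ _ _ hm hreg P hP hann
    rw [isWeaklyRegular_cons_iff] at hreg
    rw [List.forall_mem_cons] at hm
    obtain ⟨Q, hQ, hlt, hannQ⟩ := hann.exists_quotSMulTop hm.1 hreg.1
    rw [List.length_cons, Nat.cast_succ]
    exact (add_le_add_left (ih hm.2 hreg.2 hQ hannQ) 1).trans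
      (ringKrullDim_quotient_add_one_le_of_lt hlt)

/-- If `a` is `M`-regular, the associated primes of `M / aM` have dimension at least
`depth M - 1`. -/
lemma length_le_ringKrullDim_quotient_add_one (rs : List S) :
    ∀ {M : Type*} [AddCommGroup M] [Module S M] [Module.Finite S M],
      (∀ r ∈ rs, r ∈ maximalIdeal S) → IsWeaklyRegular M rs →
      ∀ {P : Ideal S} {a : S}, P.IsPrime → a ∈ P → IsSMulRegular M a →
        AnnihilatesNonzero P (QuotSMulTop a M) →
        (rs.length : WithBot ℕ∞) ≤ ringKrullDim (S ⧸ P) + 1 := by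
  induction rs with
  | nil =>
    intro M _ _ _ _ _ P a hP _ _ _
    simpa using add_nonneg (ringKrullDim_nonneg_of_nontrivial (R := S ⧸ P)) zero_le_one
  | cons x rs ih =>
    intro M _ _ _ hm hreg P a hP haP ha hann
    rw [isWeaklyRegular_cons_iff] at hreg
    rw [List.forall_mem_cons] at hm
    rw [List.length_cons, Nat.cast_succ]
    refine add_le_add_left ?_ 1
    -- If `P` contains an element `b` regular on `M/xM`, replace `a` by `b` and enlarge `P` modulo
    -- `x`: the drop in dimension pays for `x`. Otherwise `P` lies in an associated prime of `M/xM`,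
    -- and the previous bound applies.
    by_cases hex : ∃ b ∈ P, IsSMulRegular (QuotSMulTop x M) b
    · obtain ⟨b, hbP, hb⟩ := hex
      have hbM := isSMulRegular_of_isSMulRegular_quotSMulTop hm.1 hreg.1 hb
      have hannb := hann.quotSMulTop_of_isSMulRegular ha hbM hbP
      have hxb := isSMulRegular_quotSMulTop_swap hb hreg.1
      obtain ⟨Q, hQ, hlt, hannQ⟩ := hannb.exists_quotSMulTop hm.1 hxb
      exact (ih hm.2 hreg.2 hQ (hlt.le hbP) hb hannQ.quotSMulTop_swap).trans
        (ringKrullDim_quotient_add_one_le_of_lt hlt)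
    · push Not at hex
      obtain ⟨Q, hQ, hle, hannQ⟩ :=
        exists_isPrime_annihilatesNonzero_of_forall_not_isSMulRegular hex
      exact (length_le_ringKrullDim_quotient_of_annihilatesNonzero rs hm.2 hreg.2 hQ hannQ).trans
        (ringKrullDim_le_of_surjective _ (Ideal.Quotient.factor_surjective hle))

/-- A proper nonzero ideal `J` of a local domain is contained in a prime of dimension at least
`depth J - 1`. -/
lemma Ideal.exists_isPrime_le_length_le [IsDomain S] {J : Ideal S} (h0 : J ≠ ⊥) (h1 : J ≠ ⊤) :
    ∃ P : Ideal S, P.IsPrime ∧ J ≤ P ∧ ∀ rs : List S, (∀ r ∈ rs, r ∈ maximalIdeal S) →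
      IsWeaklyRegular J rs → (rs.length : WithBot ℕ∞) ≤ ringKrullDim (S ⧸ P) + 1 := by
  obtain ⟨a, haJ, ha0⟩ := Submodule.exists_mem_ne_zero_of_ne_bot h0
  have hreg : IsSMulRegular J a := by
    rw [isSMulRegular_iff_right_eq_zero_of_smul]
    rintro ⟨y, hy⟩ h
    ext
    simpa [ha0] using congrArg Subtype.val h
  have hann : AnnihilatesNonzero J (QuotSMulTop a J) := by
    refine ⟨Submodule.Quotient.mk ⟨a, haJ⟩, ?_, fun p hp ↦ ?_⟩
    · rw [Ne, QuotSMulTop.mk_eq_zero_iff]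
      rintro ⟨⟨w, hw⟩, h⟩
      have h : a * w = a * 1 := by simpa using congrArg Subtype.val h
      rw [mul_left_cancel₀ ha0 h] at hw
      exact h1 ((Ideal.eq_top_iff_one J).mpr hw)
    · rw [← Submodule.Quotient.mk_smul, QuotSMulTop.mk_eq_zero_iff]
      exact ⟨⟨p, hp⟩, Subtype.ext (mul_comm a p)⟩
  obtain ⟨P, hP, hle, hannP⟩ := exists_isPrime_annihilatesNonzero hann
  exact ⟨P, hP, hle, fun rs hm hrs ↦
    length_le_ringKrullDim_quotient_add_one rs hm hrs hP (hle haJ) hreg hannP⟩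

end Local


/-! ### Dimension inequalities and removal of prime factors -/

section Dimension

variable {R : Type*} [CommRing R]

lemma ringKrullDim_quotient_le_ringKrullDim_quotient_comap {S : Type*} [CommRing S] [Algebra R S]
    (M : Submonoid R) [IsLocalization M S] (P : Ideal S) :
    ringKrullDim (S ⧸ P) ≤ ringKrullDim (R ⧸ P.comap (algebraMap R S)) := by
  rw [ringKrullDim_quotient, ringKrullDim_quotient]
  refine Order.krullDim_le_of_strictMono
    (fun Q ↦ ⟨PrimeSpectrum.comap (algebraMap R S) Q.1, Ideal.comap_mono Q.2⟩) ?_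
  refine Monotone.strictMono_of_injective (fun Q Q' h ↦ Ideal.comap_mono h) fun Q Q' h ↦ ?_
  exact Subtype.ext (PrimeSpectrum.localization_comap_injective S M (congrArg Subtype.val h))

lemma Algebra.FiniteType.ringKrullDim_lt_top (K : Type*) [Field K] [Algebra K R]
    [Algebra.FiniteType K R] : ringKrullDim R < ⊤ := by
  obtain ⟨n, f, hf⟩ := Algebra.FiniteType.iff_quotient_mvPolynomial''.mp
    (inferInstance : Algebra.FiniteType K R)
  refine (ringKrullDim_le_of_surjective f.toRingHom hf).trans_lt ?_
  rw [MvPolynomial.ringKrullDim_of_isNoetherianRing, ringKrullDim_eq_zero_of_field, zero_add]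
  exact WithBot.coe_lt_coe.mpr (ENat.natCast_lt_top _)

/-- In a factorial domain, a prime not contained in any principal prime has height at least `2`. -/
lemma UniqueFactorizationMonoid.ringKrullDim_quotient_add_two_le [IsDomain R]
    [UniqueFactorizationMonoid R] {P : Ideal R} [hP : P.IsPrime] (h0 : P ≠ ⊥)
    (h : ∀ p : R, Prime p → ¬ P ≤ Ideal.span {p}) :
    ringKrullDim (R ⧸ P) + 1 + 1 ≤ ringKrullDim R := by
  obtain ⟨p, hpP, hp⟩ := hP.exists_mem_prime_of_ne_bot h0
  have : (Ideal.span {p}).IsPrime := (Ideal.span_singleton_prime hp.ne_zero).mpr hp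
  have hlt : Ideal.span {p} < P :=
    lt_of_le_not_ge ((Ideal.span_singleton_le_iff_mem _).mpr hpP) (h p hp)
  exact (add_le_add_left (ringKrullDim_quotient_add_one_le_of_lt hlt) 1).trans
    (ringKrullDim_quotient_succ_le_of_nonZeroDivisor
      (mem_nonZeroDivisors_iff_ne_zero.mpr hp.ne_zero))

/-- A nonzero ideal is the product of an element and an ideal without prime divisors. -/
lemma Ideal.exists_eq_map_mulLeft [IsDomain R] [IsNoetherianRing R] {I : Ideal R} (hI : I ≠ ⊥) :
    ∃ (f : R) (J : Ideal R), f ≠ 0 ∧ I = Submodule.map (LinearMap.mulLeft R f) J ∧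
      ∀ p : R, Prime p → ¬ J ≤ Ideal.span {p} := by
  obtain ⟨J, ⟨f, hf, hIJ⟩, hmax⟩ := set_has_maximal_iff_noetherian.mpr ‹IsNoetherianRing R›
    {J | ∃ f : R, f ≠ 0 ∧ I = Submodule.map (LinearMap.mulLeft R f) J}
    ⟨I, 1, one_ne_zero, by simp⟩
  refine ⟨f, J, hf, hIJ, fun p hp hle ↦ hI ?_⟩
  -- Dividing `J` by `p` gives a larger admissible ideal, so maximality forces `J = pJ`; Nakayama
  -- then gives `r ≡ 1 mod p` with `rJ = 0`.
  let J' : Ideal R := Submodule.comap (LinearMap.mulLeft R p) J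
  have hJ' : Submodule.map (LinearMap.mulLeft R p) J' = J := by
    refine le_antisymm (Submodule.map_comap_le _ _) fun x hx ↦ ?_
    obtain ⟨y, rfl⟩ := Ideal.mem_span_singleton.mp (hle hx)
    exact ⟨y, hx, rfl⟩
  have hJJ' : J ≤ J' := fun x hx ↦ Ideal.mul_mem_left J p hx
  have hmem : ∃ g : R, g ≠ 0 ∧ I = Submodule.map (LinearMap.mulLeft R g) J' := by
    refine ⟨f * p, mul_ne_zero hf hp.ne_zero, ?_⟩
    rw [LinearMap.mulLeft_mul, Submodule.map_comp, hJ', hIJ]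
  have heq : J' = J := by
    by_contra hne
    exact hmax J' hmem (lt_of_le_of_ne hJJ' (Ne.symm hne))
  rw [heq] at hJ'
  obtain ⟨r, hr, hrJ⟩ := Submodule.exists_sub_one_mem_and_smul_eq_zero_of_fg_of_le_smul
    (Ideal.span {p}) J (IsNoetherian.noetherian J) (by
      intro x hx
      rw [← hJ'] at hx
      obtain ⟨y, hy, rfl⟩ := hx
      exact Submodule.smul_mem_smul (Ideal.mem_span_singleton_self p) hy)
  have hr0 : r ≠ 0 := by
    rintro rfl
    rw [zero_sub, Ideal.mem_span_singleton, dvd_neg] at hr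
    exact hp.not_isUnit (isUnit_of_dvd_one hr)
  have hJ0 : J = ⊥ := by
    rw [eq_bot_iff]
    intro x hx
    simpa [hr0] using hrJ x hx
  rw [hIJ, hJ0, Submodule.map_bot]

end Dimension

/-! ### Homogeneous divisors and ideals -/

section Graded

variable {K R : Type*} [Field K] [CommRing R] [Algebra K R]
  (𝒜 : ℕ → Submodule K R) [GradedAlgebra 𝒜]

open DirectSum

lemma GradedAlgebra.decompose_mul_apply_eq {f g : R} {m n : ℕ}
    (h : ∀ i j, i + j = m + n → i ≠ m →
      (decompose 𝒜 f i : R) = 0 ∨ (decompose 𝒜 g j : R) = 0) :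
    (decompose 𝒜 (f * g) (m + n) : R) = decompose 𝒜 f m * decompose 𝒜 g n := by
  classical
  rw [decompose_mul, DirectSum.coe_mul_apply]
  rw [Finset.sum_eq_single (m, n)]
  · rintro ⟨i, j⟩ hij hne
    rw [Finset.mem_filter] at hij
    have : i ≠ m := by
      rintro rfl
      exact hne (Prod.ext rfl (add_left_cancel hij.2))
    rcases h i j hij.2 this with h | h <;> simp [h]
  · intro hmn
    simp only [Finset.mem_filter, Finset.mem_product, DFinsupp.mem_support_toFun, ne_eq, and_true,
      not_and_or, not_not] at hmn
    rcases hmn with h | h <;> simp [h]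

/-- A divisor of a nonzero homogeneous element of a graded domain is homogeneous. -/
lemma GradedAlgebra.isHomogeneousElem_of_mul [IsDomain R] {f g : R} (hne : f * g ≠ 0)
    (h : SetLike.IsHomogeneousElem 𝒜 (f * g)) : SetLike.IsHomogeneousElem 𝒜 f := by
  classical
  have hf : (decompose 𝒜 f).support.Nonempty := by
    rw [Finset.nonempty_iff_ne_empty, Ne, DFinsupp.support_eq_empty]
    exact fun h ↦ left_ne_zero_of_mul hne ((decompose 𝒜).injective (h.trans (decompose_zero 𝒜).symm))
  have hg : (decompose 𝒜 g).support.Nonempty := by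
    rw [Finset.nonempty_iff_ne_empty, Ne, DFinsupp.support_eq_empty]
    exact fun h ↦ right_ne_zero_of_mul hne ((decompose 𝒜).injective (h.trans (decompose_zero 𝒜).symm))
  have hzero : ∀ (r : R) (i : ℕ), i ∉ (decompose 𝒜 r).support → (decompose 𝒜 r i : R) = 0 := by
    intro r i hi
    simpa using hi
  have hnz : ∀ (r : R) (i : ℕ), i ∈ (decompose 𝒜 r).support → (decompose 𝒜 r i : R) ≠ 0 := by
    intro r i hi
    simpa using hi
  obtain ⟨d, hd⟩ := h
  have hdeg : ∀ m n : ℕ, m ∈ (decompose 𝒜 f).support → n ∈ (decompose 𝒜 g).support →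
      (∀ i j, i + j = m + n → i ≠ m →
        (decompose 𝒜 f i : R) = 0 ∨ (decompose 𝒜 g j : R) = 0) → m + n = d := by
    intro m n hm hn hmn
    by_contra hne
    have := decompose_mul_apply_eq 𝒜 hmn
    rw [decompose_of_mem_ne 𝒜 hd (Ne.symm hne)] at this
    exact mul_ne_zero (hnz f m hm) (hnz g n hn) this.symm
  -- The products of the lowest and of the highest components both survive, so both degree sums
  -- equal `d`; hence `f` has a single degree.
  have hmin := hdeg _ _ (Finset.min'_mem _ hf) (Finset.min'_mem _ hg) fun i j hij hi ↦ by
    by_contra! hc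
    have h1 := Finset.min'_le _ i (not_imp_comm.mp (hzero f i) hc.1)
    have h2 := Finset.min'_le _ j (not_imp_comm.mp (hzero g j) hc.2)
    omega
  have hmax := hdeg _ _ (Finset.max'_mem _ hf) (Finset.max'_mem _ hg) fun i j hij hi ↦ by
    by_contra! hc
    have h1 := Finset.le_max' _ i (not_imp_comm.mp (hzero f i) hc.1)
    have h2 := Finset.le_max' _ j (not_imp_comm.mp (hzero g j) hc.2)
    omega
  have hle := Finset.min'_le _ _ (Finset.max'_mem _ hg)
  refine ⟨(decompose 𝒜 f).support.min' hf, ?_⟩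
  generalize hk : (decompose 𝒜 f).support.min' hf = k at *
  rw [← sum_support_decompose 𝒜 f]
  refine Submodule.sum_mem _ fun i hi ↦ ?_
  have h1 := Finset.min'_le _ i hi
  have h2 := Finset.le_max' _ i hi
  have : i = k := by omega
  rw [← this]
  exact (decompose 𝒜 f i).2

/-- A proper homogeneous ideal is contained in the irrelevant ideal when `R₀` is a field. -/
lemma Ideal.IsHomogeneous.le_irrelevant (h0 : 𝒜 0 = (Algebra.linearMap K R).range) {J : Ideal R}
    (hJ : J.IsHomogeneous 𝒜) (hne : J ≠ ⊤) : J ≤ (HomogeneousIdeal.irrelevant 𝒜).toIdeal := by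
  intro x hx
  change (decompose 𝒜 x 0 : R) = 0
  have hx0 : (decompose 𝒜 x 0 : R) ∈ J := hJ 0 hx
  obtain ⟨c, hc⟩ : (decompose 𝒜 x 0 : R) ∈ (Algebra.linearMap K R).range :=
    h0 ▸ (decompose 𝒜 x 0).2
  rw [← hc] at hx0 ⊢
  by_contra hcne
  have hc0 : c ≠ 0 := by rintro rfl; simp at hcne
  exact hne (Ideal.eq_top_of_isUnit_mem J hx0 ((IsUnit.mk0 c hc0).map (algebraMap K R)))

end Graded

/-! ### Passage to the localization at `R₊`, and the conclusion -/

namespace GradedCM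

variable {K R : Type*} [Field K] [CommRing R] [Algebra K R]
  (𝒜 : ℕ → Submodule K R) [GradedAlgebra 𝒜]

lemma depth_congr {M N : Type*} [AddCommGroup M] [Module R M] [AddCommGroup N] [Module R N]
    (e : M ≃ₗ[R] N) : depth 𝒜 M = depth 𝒜 N := by
  simp only [depth, grade, e.isWeaklyRegular_congr]

lemma isCohenMacaulay_congr {M N : Type*} [AddCommGroup M] [Module R M] [AddCommGroup N]
    [Module R N] (e : M ≃ₗ[R] N) : IsCohenMacaulay 𝒜 M ↔ IsCohenMacaulay 𝒜 N := by
  rw [IsCohenMacaulay, IsCohenMacaulay, depth_congr 𝒜 e, dim, dim, e.annihilator_eq]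

/-- A proper ideal contained in `R₊` is contained in a prime of dimension at least its
depth minus one. -/
lemma exists_isPrime_le_depth_le [IsDomain R] [IsNoetherianRing R] {J : Ideal R} (hJ0 : J ≠ ⊥)
    (hJ : J ≤ (HomogeneousIdeal.irrelevant 𝒜).toIdeal) :
    ∃ P : Ideal R, P.IsPrime ∧ J ≤ P ∧
      ((depth 𝒜 J : ℕ∞) : WithBot ℕ∞) ≤ ringKrullDim (R ⧸ P) + 1 := by
  set 𝔪 := (HomogeneousIdeal.irrelevant 𝒜).toIdeal with h𝔪
  have : 𝔪.IsPrime := by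
    rw [h𝔪, HomogeneousIdeal.toIdeal_irrelevant]
    exact RingHom.ker_isPrime _
  let S := Localization.AtPrime 𝔪
  have : IsNoetherianRing S := IsLocalization.isNoetherianRing 𝔪.primeCompl S inferInstance
  have hinj : Function.Injective (algebraMap R S) :=
    IsLocalization.injective S 𝔪.primeCompl_le_nonZeroDivisors
  have hmax : 𝔪.map (algebraMap R S) = maximalIdeal S := Localization.AtPrime.map_eq_maximalIdeal
  have hS0 : J.map (algebraMap R S) ≠ ⊥ := by
    rwa [Ne, Ideal.map_eq_bot_iff_of_injective hinj]
  have hS1 : J.map (algebraMap R S) ≠ ⊤ := by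
    intro h
    have := Ideal.map_mono (f := algebraMap R S) hJ
    rw [h, hmax, top_le_iff] at this
    exact (maximalIdeal.isMaximal S).ne_top this
  obtain ⟨P, hP, hle, hlen⟩ := Ideal.exists_isPrime_le_length_le hS0 hS1
  refine ⟨P.comap (algebraMap R S), inferInstance, Ideal.map_le_iff_le_comap.mp hle, ?_⟩
  have hdim := add_le_add_left
    (ringKrullDim_quotient_le_ringKrullDim_quotient_comap 𝔪.primeCompl P) 1
  -- The empty sequence excludes `⊥`, so the bound can be compared in `ℕ∞`, where depth is a
  -- supremum.
  have hbot : ringKrullDim (S ⧸ P) + 1 ≠ ⊥ :=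
    ne_bot_of_le_ne_bot (by simp) (hlen [] (by simp) (by simp))
  refine le_trans ?_ hdim
  rw [← WithBot.coe_unbot _ hbot, WithBot.coe_le_coe]
  refine iSup_le fun rs ↦ iSup_le fun hrs ↦ iSup_le fun hreg ↦ ?_
  rw [← WithBot.coe_le_coe, WithBot.coe_unbot]
  have := hlen (rs.map (algebraMap R S)) ?_
    (hreg.of_isLocalizedModule S 𝔪.primeCompl (Algebra.idealMap S J))
  · simpa using this
  · intro s hs
    obtain ⟨r, hr, rfl⟩ := List.mem_map.mp hs
    rw [← hmax]
    exact Ideal.mem_map_of_mem _ (hrs r hr).2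

theorem not_isCohenMacaulay_of_not_isPrincipal [IsDomain R] [UniqueFactorizationMonoid R]
    [Algebra.FiniteType K R] (h0 : 𝒜 0 = (Algebra.linearMap K R).range) {I : Ideal R}
    (hI : I.IsHomogeneous 𝒜) (hprin : ¬ I.IsPrincipal) : ¬ IsCohenMacaulay 𝒜 I := by
  have : IsNoetherianRing R := Algebra.FiniteType.isNoetherianRing K R
  have hI0 : I ≠ ⊥ := by
    rintro rfl
    exact hprin inferInstance
  obtain ⟨f, J, hf, hIJ, hJ⟩ := Ideal.exists_eq_map_mulLeft hI0
  have hmem : ∀ r, r ∈ J ↔ f * r ∈ I := fun r ↦ by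
    rw [hIJ]
    exact ⟨fun h ↦ ⟨r, h, rfl⟩, fun ⟨s, hs, h⟩ ↦ mul_left_cancel₀ hf h ▸ hs⟩
  -- `f` divides a nonzero homogeneous component of an element of `I`.
  have hfhom : SetLike.IsHomogeneousElem 𝒜 f := by
    obtain ⟨x, hx, hx0⟩ := Submodule.exists_mem_ne_zero_of_ne_bot hI0
    obtain ⟨i, hi⟩ : ∃ i, (DirectSum.decompose 𝒜 x i : R) ≠ 0 := by
      by_contra! h
      refine hx0 ((DirectSum.decompose 𝒜).injective ?_)
      rw [DirectSum.decompose_zero]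
      exact DFinsupp.ext fun i ↦ Subtype.ext (h i)
    have hxi := hI i hx
    rw [hIJ] at hxi
    obtain ⟨g, -, hg⟩ := hxi
    rw [LinearMap.mulLeft_apply] at hg
    refine GradedAlgebra.isHomogeneousElem_of_mul 𝒜 (g := g) (hg ▸ hi) ?_
    rw [hg]
    exact ⟨i, (DirectSum.decompose 𝒜 x i).2⟩
  have hJhom : J.IsHomogeneous 𝒜 := by
    obtain ⟨d, hd⟩ := hfhom
    intro i r hr
    rw [hmem] at hr ⊢
    rw [← DirectSum.coe_decompose_mul_add_of_left_mem 𝒜 hd]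
    exact hI (d + i) hr
  have hJtop : J ≠ ⊤ := by
    rintro rfl
    refine hprin ⟨⟨f, ?_⟩⟩
    ext x
    rw [hIJ, Submodule.mem_span_singleton]
    simp [mul_comm]
  have hJ0 : J ≠ ⊥ := by
    rintro rfl
    exact hI0 (by rw [hIJ, Submodule.map_bot])
  have e : J ≃ₗ[R] I := (Submodule.equivMapOfInjective (LinearMap.mulLeft R f)
    (mul_right_injective₀ hf) J).trans (LinearEquiv.ofEq _ _ hIJ.symm)
  rw [← isCohenMacaulay_congr 𝒜 e]
  intro hCM
  obtain ⟨P, hP, hle, hdepth⟩ :=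
    exists_isPrime_le_depth_le 𝒜 hJ0 (hJhom.le_irrelevant 𝒜 h0 hJtop)
  have hann : Module.annihilator R J = ⊥ := by
    obtain ⟨x, hx, hx0⟩ := Submodule.exists_mem_ne_zero_of_ne_bot hJ0
    rw [eq_bot_iff]
    intro r hr
    simpa [hx0] using congrArg Subtype.val (Module.mem_annihilator.mp hr ⟨x, hx⟩)
  have hdim : dim R J = ringKrullDim R := by
    rw [dim, hann]
    exact ringKrullDim_eq_of_ringEquiv (RingEquiv.quotientBot R)
  rw [IsCohenMacaulay, hdim] at hCM
  rw [hCM] at hdepth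
  have hheight := UniqueFactorizationMonoid.ringKrullDim_quotient_add_two_le
    (P := P) (fun h ↦ hJ0 (le_bot_iff.mp (h ▸ hle))) fun p hp h ↦ hJ p hp (hle.trans h)
  have hlt := Algebra.FiniteType.ringKrullDim_lt_top (R := R) K
  have hbot : ringKrullDim R ≠ ⊥ :=
    (bot_lt_iff_ne_bot.mp ((WithBot.bot_lt_coe 0).trans_le ringKrullDim_nonneg_of_nontrivial))
  -- This reads `dim R + 1 ≤ dim R`, absurd because `dim R` is finite.
  have := (add_le_add_left hdepth 1).trans hheight
  obtain ⟨d, hd⟩ := WithBot.ne_bot_iff_exists.mp hbot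
  rw [← hd] at this hlt
  obtain ⟨n, rfl⟩ := ENat.ne_top_iff_exists.mp (WithBot.coe_lt_coe.mp hlt).ne
  have h' : (n + 1 : ℕ∞) ≤ n := WithBot.coe_le_coe.mp this
  norm_cast at h'
  omega

end GradedCM

theorem mainTheorem2 {K R : Type*} [Field K] [CommRing R] [IsDomain R]
    [UniqueFactorizationMonoid R] [Algebra K R] [Algebra.FiniteType K R]
    (𝒜 : ℕ → Submodule K R) [GradedAlgebra 𝒜]
    (h0 : 𝒜 0 = (Algebra.linearMap K R).range) :
    (∀ I : Ideal R, I.IsHomogeneous 𝒜 → I ≠ ⊤ → ¬ I.IsPrincipal →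
      ¬ GradedCM.IsCohenMacaulay 𝒜 I) ∧
    (¬ GradedCM.IsCohenMacaulay 𝒜 R →
      ∀ I : Ideal R, I.IsHomogeneous 𝒜 → I ≠ ⊥ → ¬ GradedCM.IsCohenMacaulay 𝒜 I) := by
  refine ⟨fun I hI _ hprin ↦ GradedCM.not_isCohenMacaulay_of_not_isPrincipal 𝒜 h0 hI hprin,
    fun hR I hI hne ↦ ?_⟩
  by_cases hprin : I.IsPrincipal
  · obtain ⟨f, rfl⟩ := hprin
    have hf : f ≠ 0 := by
      rintro rfl
      simp at hne
    rwa [← GradedCM.isCohenMacaulay_congr 𝒜 (LinearEquiv.toSpanNonzeroSingleton R R f hf)]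
  · exact GradedCM.not_isCohenMacaulay_of_not_isPrincipal 𝒜 h0 hI hprin
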